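/- Let $R$ be a commutative ring with unity. Then the following conditions are equivalent: 1. $R$ is a coherent $DW$-ring; 2. every finitely generated submodule of a projective $R$-module is $w$-FP-projective; 3. every finitely generated ideal of $R$ is $w$-FP-projective. Here $R$ is coherent if every finitely generated ideal of $R$ is finitely presented. A $GV$-ideal is a finitely generated ideal $J$ of $R$ for which the natural map $R\to \mathrm{Hom}_R(J,R)$ is an isomorphism. An $R$-module $M$ is $GV$-torsion-free if no nonzero element of $M$ is annihilated by a $GV$-ideal; it is a $w$-module if moreover $\mathrm{Ext}^1_R(R/J,M)=0$ for every $GV$-ideal $J$. A $w$-ideal is an ideal which is a $w$-module, $w\text{-}\mathrm{Max}(R)$ is the set of ideals maximal among the proper $w$-ideals (these are prime), and $R$ is a $DW$-ring if every ideal of $R$ is a $w$-ideal. A sequence $0\to A\to B\to C\to 0$ of $R$-modules is $w$-exact if its localization at each $\mathfrak p\in w\text{-}\mathrm{Max}(R)$ is exact, and a $w$-exact sequence is $w$-pure exact if $0\to A\otimes_R M\to B\otimes_R M\to C\otimes_R M\to 0$ is $w$-exact for every $R$-module $M$. A submodule $A\subseteq B$ is $w$-pure if $0\to A\to B\to B/A\to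 0$ is $w$-pure exact, and an $R$-module is absolutely $w$-pure if it is a $w$-pure submodule of every $R$-module containing it as a submodule. Finally, an $R$-module $M$ is $w$-FP-projective if $\mathrm{Ext}^1_R(M,A)=0$ for every absolutely $w$-pure $R$-module $A$. -/

import Mathlib

universe u

open CategoryTheory

/-- A Glaz-Vasconcelos ideal: a finitely generated ideal `J` such that the natural map
`R → Hom_R(J, R)`, `r ↦ (j ↦ r * j)`, is an isomorphism. -/
def IsGVIdeal {R : Type u} [CommRing R] (J : Ideal R) : Prop :=
  J.FG ∧ Function.Bijective
    (LinearMap.toSpanSingleton R (J →ₗ[R] R) (Submodule.subtype J))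

/-- A module is `GV`-torsion-free if `0` is its only element killed by a `GV`-ideal. -/
def IsGVTorsionFree (R : Type u) [CommRing R] (M : Type u) [AddCommGroup M] [Module R M] : Prop :=
  ∀ x : M, (∃ J : Ideal R, IsGVIdeal J ∧ ∀ j ∈ J, j • x = 0) → x = 0

/-- A `w`-module: a `GV`-torsion-free module `M` with `Ext¹(R/J, M) = 0` for every
`GV`-ideal `J`. -/
def IsWModule (R : Type u) [CommRing R] (M : Type u) [AddCommGroup M] [Module R M] : Prop :=
  IsGVTorsionFree R M ∧
    ∀ J : Ideal R, IsGVIdeal J →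
      Subsingleton (Abelian.Ext (ModuleCat.of R (R ⧸ J)) (ModuleCat.of R M) 1)

/-- A `w`-ideal: an ideal that is a `w`-module. -/
def IsWIdeal {R : Type u} [CommRing R] (I : Ideal R) : Prop :=
  IsWModule R I

/-- A `DW`-ring: every ideal is a `w`-ideal. -/
def IsDWRing (R : Type u) [CommRing R] : Prop :=
  ∀ I : Ideal R, IsWIdeal I

/-- A coherent ring: every finitely generated ideal is finitely presented. -/
def IsCoherentCommRing (R : Type u) [CommRing R] : Prop :=
  ∀ I : Ideal R, I.FG → Module.FinitePresentation R I

/-- A maximal `w`-ideal: an ideal maximal among the proper `w`-ideals. -/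
def IsMaximalWIdeal {R : Type u} [CommRing R] (p : Ideal R) : Prop :=
  Maximal (fun I : Ideal R => IsWIdeal I ∧ I ≠ ⊤) p

/-- `0 → A → B → C → 0` is `w`-exact if its localization at every maximal `w`-ideal is exact.
Maximal `w`-ideals are always prime; `p.IsPrime` is there only to make the localization
meaningful. -/
def IsWExact {R : Type u} [CommRing R] {A B C : Type u}
    [AddCommGroup A] [Module R A] [AddCommGroup B] [Module R B] [AddCommGroup C] [Module R C]
    (f : A →ₗ[R] B) (g : B →ₗ[R] C) : Prop :=
  ∀ (p : Ideal R) [p.IsPrime], IsMaximalWIdeal p →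
    Function.Injective (LocalizedModule.map p.primeCompl f) ∧
    Function.Exact (LocalizedModule.map p.primeCompl f) (LocalizedModule.map p.primeCompl g) ∧
    Function.Surjective (LocalizedModule.map p.primeCompl g)

/-- A `w`-exact sequence `0 → A → B → C → 0` is `w`-pure exact if
`0 → A ⊗ M → B ⊗ M → C ⊗ M → 0` is `w`-exact for every module `M`. -/
def IsWPureExact {R : Type u} [CommRing R] {A B C : Type u}
    [AddCommGroup A] [Module R A] [AddCommGroup B] [Module R B] [AddCommGroup C] [Module R C]
    (f : A →ₗ[R] B) (g : B →ₗ[R] C) : Prop :=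
  IsWExact f g ∧
    ∀ (M : Type u) [AddCommGroup M] [Module R M], IsWExact (f.rTensor M) (g.rTensor M)

/-- `A` is a `w`-pure submodule of `B` if `0 → A → B → B/A → 0` is `w`-pure exact. -/
def IsWPureSubmodule {R : Type u} [CommRing R] {B : Type u} [AddCommGroup B] [Module R B]
    (A : Submodule R B) : Prop :=
  IsWPureExact A.subtype A.mkQ

/-- `A` is absolutely `w`-pure if it is a `w`-pure submodule of every module containing it. -/
def IsAbsolutelyWPure (R : Type u) [CommRing R] (A : Type u) [AddCommGroup A] [Module R A] :
    Prop :=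
  ∀ (B : Type u) [AddCommGroup B] [Module R B] (i : A →ₗ[R] B), Function.Injective i →
    IsWPureSubmodule (LinearMap.range i)

/-- `M` is `w`-`FP`-projective if `Ext¹(M, A) = 0` for every absolutely `w`-pure module `A`. -/
def IsWFPProjective (R : Type u) [CommRing R] (M : Type u) [AddCommGroup M] [Module R M] :
    Prop :=
  ∀ (A : Type u) [AddCommGroup A] [Module R A], IsAbsolutelyWPure R A →
    Subsingleton (Abelian.Ext (ModuleCat.of R M) (ModuleCat.of R A) 1)

section

variable {R : Type u} [CommRing R]

/-! ### Vanishing of `Ext¹` and extension of linear maps -/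

/-! For M = F/K with F projective, Ext¹(M, A) = 0 says that every map K → A extends to F, so all
depends on having enough absolutely w-pure test modules A.

From 3 to 1, two families suffice. Eventually zero families of injectives force a finitely generated
w-FP-projective module to be finitely presented, whence coherence. Modules killed by a GV-ideal J
vanish at each maximal w-ideal, so they are absolutely w-pure; testing J itself against K/JK, with K
the relations of J, gives J = R by Cayley–Hamilton. Without proper GV-ideals every ideal is a
w-ideal.

From 1 to 2, finitely generated submodules of projectives are finitely presented by coherence. Over
a DW-ring w-purity is purity, so an absolutely w-pure A is pure in an injective module, and Ext¹
from finitely presented modules to A vanishes. -/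

theorem exists_extend_of_subsingleton_ext {K F M A : Type u}
    [AddCommGroup K] [Module R K] [AddCommGroup F] [Module R F]
    [AddCommGroup M] [Module R M] [AddCommGroup A] [Module R A]
    {i : K →ₗ[R] F} {g : F →ₗ[R] M} (hi : Function.Injective i) (hg : Function.Surjective g)
    (hig : Function.Exact i g)
    (h : Subsingleton (Abelian.Ext (ModuleCat.of R M) (ModuleCat.of R A) 1))
    (f : K →ₗ[R] A) : ∃ f' : F →ₗ[R] A, f' ∘ₗ i = f := by
  let S := ModuleCat.shortComplexOfCompEqZero i g hig.linearMap_comp_eq_zero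
  have hS : S.ShortExact := ModuleCat.shortComplex_shortExact S hig hi hg
  obtain ⟨x, hx⟩ := Abelian.Ext.contravariant_sequence_exact₁ hS (ModuleCat.of R A)
    (Abelian.Ext.mk₀ (ModuleCat.ofHom f)) (n₁ := 1) rfl (h.elim _ _)
  obtain ⟨y, rfl⟩ := Abelian.Ext.addEquiv₀.symm.surjective x
  have hy : S.f ≫ y = ModuleCat.ofHom f := by
    apply Abelian.Ext.addEquiv₀.symm.injective
    simpa using hx
  exact ⟨y.hom, by simpa [S] using congrArg ModuleCat.Hom.hom hy⟩

theorem subsingleton_ext_of_exists_extend {K F M A : Type u}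
    [AddCommGroup K] [Module R K] [AddCommGroup F] [Module R F] [Module.Projective R F]
    [AddCommGroup M] [Module R M] [AddCommGroup A] [Module R A]
    {i : K →ₗ[R] F} {g : F →ₗ[R] M} (hi : Function.Injective i) (hg : Function.Surjective g)
    (hig : Function.Exact i g)
    (h : ∀ f : K →ₗ[R] A, ∃ f' : F →ₗ[R] A, f' ∘ₗ i = f) :
    Subsingleton (Abelian.Ext (ModuleCat.of R M) (ModuleCat.of R A) 1) := by
  let S := ModuleCat.shortComplexOfCompEqZero i g hig.linearMap_comp_eq_zero
  have hS : S.ShortExact := ModuleCat.shortComplex_shortExact S hig hi hg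
  have : Projective S.X₂ := (ModuleCat.of R F).projective_of_categoryTheory_projective
  refine subsingleton_of_forall_eq 0 fun x ↦ ?_
  obtain ⟨y, rfl⟩ := Abelian.Ext.contravariant_sequence_exact₃ hS (ModuleCat.of R A) x
    (Abelian.Ext.eq_zero_of_projective (n := 0) _) (n₀ := 0) rfl
  obtain ⟨z, rfl⟩ := Abelian.Ext.addEquiv₀.symm.surjective y
  obtain ⟨f', hf'⟩ := h z.hom
  have hz : z = S.f ≫ ModuleCat.ofHom f' := by
    ext x
    exact (LinearMap.congr_fun hf' x).symm
  rw [hz]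
  simp [← Abelian.Ext.mk₀_comp_mk₀]

/-! ### `w`-purity and localization -/

theorem isWPureSubmodule_of_injective {B : Type u} [AddCommGroup B] [Module R B]
    (A : Submodule R B)
    (h : ∀ (M : Type u) [AddCommGroup M] [Module R M] (p : Ideal R) [p.IsPrime],
      IsMaximalWIdeal p →
      Function.Injective (LocalizedModule.map p.primeCompl (A.subtype.rTensor M))) :
    IsWPureSubmodule A := by
  have hex : Function.Exact A.subtype A.mkQ := LinearMap.exact_subtype_mkQ A
  have hsurj : Function.Surjective A.mkQ := A.mkQ_surjective
  refine ⟨fun p _ _ ↦ ⟨LocalizedModule.map_injective _ _ A.subtype_injective,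
    LocalizedModule.map_exact _ _ _ hex, LocalizedModule.map_surjective _ _ hsurj⟩,
    fun M _ _ p _ hp ↦ ⟨h M p hp, LocalizedModule.map_exact _ _ _ (rTensor_exact M hex hsurj),
      LocalizedModule.map_surjective _ _ (LinearMap.rTensor_surjective M hsurj)⟩⟩

theorem isAbsolutelyWPure_of_injective {A : Type u} [AddCommGroup A] [Module R A]
    (h : ∀ (B : Type u) [AddCommGroup B] [Module R B] (i : A →ₗ[R] B), Function.Injective i →
      ∀ (M : Type u) [AddCommGroup M] [Module R M] (p : Ideal R) [p.IsPrime], IsMaximalWIdeal p →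
      Function.Injective (LocalizedModule.map p.primeCompl (i.rTensor M))) :
    IsAbsolutelyWPure R A := by
  intro B _ _ i hi
  refine isWPureSubmodule_of_injective _ fun M _ _ p _ hp ↦ ?_
  have hs : Function.Surjective
      (LocalizedModule.map p.primeCompl (i.rangeRestrict.rTensor M)) :=
    LocalizedModule.map_surjective _ _
      (LinearMap.rTensor_surjective M i.surjective_rangeRestrict)
  refine Function.Injective.of_comp_right (g := LocalizedModule.map p.primeCompl
    (i.rangeRestrict.rTensor M)) ?_ hs
  have key := h B i hi M p hp
  intro x y hxy
  apply key
  induction x using LocalizedModule.induction_on with | _ x s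
  induction y using LocalizedModule.induction_on with | _ y t
  have hi' (z) : i.range.subtype.rTensor M (i.rangeRestrict.rTensor M z) = i.rTensor M z := by
    rw [← LinearMap.rTensor_comp_apply]; rfl
  simpa [LocalizedModule.map_mk, hi'] using hxy

/-- A module in which every finitely generated submodule is contained in an injective submodule is
absolutely `w`-pure. -/
theorem isAbsolutelyWPure_of_fg_le_injective {A : Type u} [AddCommGroup A] [Module R A]
    (h : ∀ S : Submodule R A, S.FG → ∃ E : Submodule R A, Module.Injective R E ∧ S ≤ E) :
    IsAbsolutelyWPure R A := by
  refine isAbsolutelyWPure_of_injective fun B _ _ i hi M _ _ p _ _ ↦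
    LocalizedModule.map_injective _ _ ((injective_iff_map_eq_zero _).2 fun t ht ↦ ?_)
  obtain ⟨S, hS, hSt⟩ := TensorProduct.exists_finite_submodule_left_of_setFinite {t}
    (Set.finite_singleton t)
  obtain ⟨E, hE, hSE⟩ := h S (Module.Finite.iff_fg.1 ‹_›)
  obtain ⟨s, hs⟩ := hSt rfl
  -- The retraction `ρ` of B onto E recovers t, which comes from E ⊗ M, from its image in B ⊗ M.
  obtain ⟨ρ, hρ⟩ := Module.Injective.extension_property R E E B (i ∘ₗ E.subtype)
    (hi.comp E.subtype_injective) LinearMap.id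
  have ht' : t = (E.subtype.rTensor M) ((Submodule.inclusion hSE).rTensor M s) := by
    rw [← hs, ← LinearMap.comp_apply, ← LinearMap.rTensor_comp]; rfl
  have : (ρ.rTensor M) (i.rTensor M t) = (Submodule.inclusion hSE).rTensor M s := by
    rw [ht', ← LinearMap.comp_apply (i.rTensor M), ← LinearMap.rTensor_comp, ← LinearMap.comp_apply,
      ← LinearMap.rTensor_comp, hρ, LinearMap.rTensor_id, LinearMap.id_apply]
  rw [ht', ← this, ht, map_zero, map_zero]

/-! ### `GV`-ideals -/

theorem IsGVIdeal.eq_zero_of_mul_eq_zero {J : Ideal R} (hJ : IsGVIdeal J) {r : R}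
    (h : ∀ j ∈ J, r * j = 0) : r = 0 := by
  apply hJ.2.1
  ext j
  simpa using h j j.2

/-- If J ≤ p, the inclusion J → p extends to R; the image of 1 fixes J under multiplication, so it
equals 1 and lies in p. -/
theorem IsGVIdeal.not_le {J : Ideal R} (hJ : IsGVIdeal J) {p : Ideal R} (hp : IsWIdeal p)
    (hp' : p ≠ ⊤) : ¬ J ≤ p := by
  intro hle
  obtain ⟨f, hf⟩ := exists_extend_of_subsingleton_ext J.subtype_injective J.mkQ_surjective
    (LinearMap.exact_subtype_mkQ J) (hp.2 J hJ) (Submodule.inclusion hle)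
  have hf' : ∀ j ∈ J, (f 1 : R) * j = j := fun j hj ↦ by
    have := congrArg Subtype.val (LinearMap.congr_fun hf ⟨j, hj⟩)
    have hj1 : f j = j • f 1 := by rw [← map_smul, smul_eq_mul, mul_one]
    simpa [hj1, mul_comm] using this
  have h1 : (f 1 : R) - 1 = 0 := hJ.eq_zero_of_mul_eq_zero fun j hj ↦ by
    rw [sub_mul, hf' j hj, one_mul, sub_self]
  exact hp' ((Ideal.eq_top_iff_one p).2 (sub_eq_zero.1 h1 ▸ (f 1).2))

theorem IsGVIdeal.isAbsolutelyWPure {J : Ideal R} (hJ : IsGVIdeal J) {A : Type u} [AddCommGroup A]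
    [Module R A] (hA : ∀ j ∈ J, ∀ a : A, j • a = 0) : IsAbsolutelyWPure R A := by
  refine isAbsolutelyWPure_of_injective fun B _ _ i hi M _ _ p _ hp ↦ ?_
  obtain ⟨j, hjJ, hjp⟩ := Set.not_subset.1 (hJ.not_le hp.1.1 hp.1.2)
  have : Subsingleton (LocalizedModule p.primeCompl (TensorProduct R A M)) := by
    refine LocalizedModule.subsingleton_iff.2 fun t ↦ ⟨j, hjp, ?_⟩
    induction t with
    | zero => simp
    | add x y hx hy => rw [smul_add, hx, hy, add_zero]
    | tmul a m => rw [TensorProduct.smul_tmul', hA j hjJ, TensorProduct.zero_tmul]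
  exact Function.injective_of_subsingleton _

/-! ### Finitely generated `w`-`FP`-projective modules are finitely presented -/

/-- If `σ` is an endomorphism of a finitely generated module `K` with `(σ - 1) K ⊆ J K`, then some
scalar in `1 + J` is a left multiple of `σ`. -/
theorem exists_comp_eq_smul_of_range_sub_one_le {K : Type*} [AddCommGroup K] [Module R K]
    [Module.Finite R K] (J : Ideal R) (σ : Module.End R K)
    (hσ : LinearMap.range (σ - 1) ≤ J • ⊤) :
    ∃ (c : R) (τ : Module.End R K), c - 1 ∈ J ∧ τ * σ = algebraMap R _ c := by
  have hσ' : LinearMap.range (1 - σ) ≤ J • ⊤ := by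
    rintro _ ⟨x, rfl⟩
    rw [← neg_sub, LinearMap.neg_apply]
    exact neg_mem (hσ ⟨x, rfl⟩)
  obtain ⟨p, hp, -, hc, h0⟩ :=
    LinearMap.exists_monic_and_natDegree_eq_and_coeff_mem_pow_and_aeval_eq_zero R (1 - σ) J hσ'
  -- At 1 - σ, X - 1 becomes -σ and p becomes 0, so p - p(1) = (X - 1)q gives c = p(1) and τ = q(1 -
  -- σ).
  obtain ⟨q, hq⟩ := Polynomial.X_sub_C_dvd_sub_C_eval (a := (1 : R)) (p := p)
  refine ⟨p.eval 1, Polynomial.aeval (1 - σ) q, ?_, ?_⟩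
  · rw [Polynomial.eval_eq_sum_range, Finset.sum_range_succ, hp.coeff_natDegree, one_mul, one_pow,
      add_sub_cancel_right]
    refine Ideal.sum_mem _ fun k hk ↦ Ideal.mul_mem_right _ _ ?_
    exact Ideal.pow_le_self (by have := Finset.mem_range.1 hk; omega) (hc k)
  · have := congrArg (Polynomial.aeval (1 - σ)) hq
    rw [mul_comm] at this
    simp only [map_sub, map_mul, h0, Polynomial.aeval_X, Polynomial.aeval_C, map_one] at this
    rw [sub_sub_cancel_left, mul_neg, zero_sub, neg_inj] at this
    exact this.symm

theorem exists_injective_module (M : Type u) [AddCommGroup M] [Module R M] :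
    ∃ (E : Type u) (_ : AddCommGroup E) (_ : Module R E) (_ : Module.Injective R E)
      (i : M →ₗ[R] E), Function.Injective i :=
  ⟨(Injective.under (ModuleCat.of R M) : ModuleCat R), inferInstance, inferInstance,
    (Module.injective_iff_injective_object R _).2 (Injective.injective_under (ModuleCat.of R M)),
    (Injective.ι (ModuleCat.of R M)).hom,
    (ModuleCat.mono_iff_injective _).1 inferInstance⟩

/-- The families in a product over a directed preorder that vanish eventually. -/
def eventuallyZero (R : Type*) [CommRing R] {ι : Type*} [Preorder ι] [IsDirectedOrder ι]
    [Nonempty ι] (E : ι → Type*) [∀ i, AddCommGroup (E i)] [∀ i, Module R (E i)] :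
    Submodule R (∀ i, E i) where
  carrier := {x | ∃ i, ∀ j, i ≤ j → x j = 0}
  zero_mem' := ⟨Classical.arbitrary ι, fun _ _ ↦ rfl⟩
  add_mem' := by
    rintro x y ⟨i, hi⟩ ⟨j, hj⟩
    obtain ⟨k, hik, hjk⟩ := exists_ge_ge i j
    exact ⟨k, fun l hl ↦ by rw [Pi.add_apply, hi l (hik.trans hl), hj l (hjk.trans hl), add_zero]⟩
  smul_mem' := by
    rintro r x ⟨i, hi⟩
    exact ⟨i, fun j hj ↦ by rw [Pi.smul_apply, hi j hj, smul_zero]⟩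

section eventuallyZero

variable {ι : Type u} [Preorder ι] [IsDirectedOrder ι] [Nonempty ι] (E : ι → Type u)
  [∀ i, AddCommGroup (E i)] [∀ i, Module R (E i)]

theorem exists_forall_eq_zero_of_fg_le_eventuallyZero {S : Submodule R (∀ i, E i)} (hS : S.FG)
    (hle : S ≤ eventuallyZero R E) : ∃ i, ∀ x ∈ S, ∀ j, i ≤ j → x j = 0 := by
  induction S, hS using Submodule.fg_induction with
  | singleton x =>
    obtain ⟨i, hi⟩ := hle (Submodule.mem_span_singleton_self x)
    refine ⟨i, fun y hy j hj ↦ ?_⟩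
    obtain ⟨r, rfl⟩ := Submodule.mem_span_singleton.1 hy
    rw [Pi.smul_apply, hi j hj, smul_zero]
  | sup S T _ _ hS hT =>
    obtain ⟨i, hi⟩ := hS (le_sup_left.trans hle)
    obtain ⟨j, hj⟩ := hT (le_sup_right.trans hle)
    obtain ⟨k, hik, hjk⟩ := exists_ge_ge i j
    refine ⟨k, fun x hx l hl ↦ ?_⟩
    obtain ⟨y, hy, z, hz, rfl⟩ := Submodule.mem_sup.1 hx
    rw [Pi.add_apply, hi y hy l (hik.trans hl), hj z hz l (hjk.trans hl), add_zero]

/-- The families vanishing from a fixed index on form a direct factor of the full product, hence an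
injective module. -/
theorem isAbsolutelyWPure_eventuallyZero [∀ i, Module.Injective R (E i)] :
    IsAbsolutelyWPure R (eventuallyZero R E) := by
  classical
  refine isAbsolutelyWPure_of_fg_le_injective fun S hS ↦ ?_
  obtain ⟨i, hi⟩ := exists_forall_eq_zero_of_fg_le_eventuallyZero E
    (hS.map (eventuallyZero R E).subtype) (Submodule.map_subtype_le _ _)
  let T : Submodule R (eventuallyZero R E) :=
    { carrier := {x | ∀ j, i ≤ j → x.1 j = 0}
      zero_mem' := fun _ _ ↦ rfl
      add_mem' := fun {x y} hx hy j hj ↦ by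
        change x.1 j + y.1 j = 0
        rw [hx j hj, hy j hj, add_zero]
      smul_mem' := fun r x hx j hj ↦ by
        change r • x.1 j = 0
        rw [hx j hj, smul_zero] }
  refine ⟨T, ⟨fun X Y _ _ _ _ f hf g ↦ ?_⟩, fun x hx ↦ hi x ⟨x, hx, rfl⟩⟩
  obtain ⟨h, hh⟩ := Module.Injective.extension_property R (∀ i, E i) X Y f hf
    ((eventuallyZero R E).subtype ∘ₗ T.subtype ∘ₗ g)
  let π : (∀ j, E j) →ₗ[R] (∀ j, E j) :=
    LinearMap.pi fun j ↦ if i ≤ j then 0 else LinearMap.proj j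
  have hπ (x j) (hj : i ≤ j) : π x j = 0 := by simp [π, hj]
  refine ⟨((π ∘ₗ h).codRestrict (eventuallyZero R E) fun y ↦ ⟨i, hπ _⟩).codRestrict T
    fun y ↦ hπ _, fun x ↦ ?_⟩
  ext j
  have hx : h (f x) j = (g x).1.1 j := congrFun (LinearMap.congr_fun hh x) j
  change π (h (f x)) j = _
  by_cases hj : i ≤ j
  · rw [hπ _ _ hj, (g x).2 j hj]
  · simp [π, hj, hx]

end eventuallyZero

theorem IsWFPProjective.finitePresentation {M : Type u} [AddCommGroup M] [Module R M]
    [Module.Finite R M] (h : IsWFPProjective R M) : Module.FinitePresentation R M := by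
  obtain ⟨n, g, hg⟩ := Module.Finite.exists_fin' R M
  refine Module.finitePresentation_of_surjective g hg ?_
  set K := LinearMap.ker g
  let ι := {S : Submodule R K // S.FG}
  have : IsDirectedOrder ι := ⟨fun S T ↦ ⟨⟨S.1 ⊔ T.1, S.2.sup T.2⟩,
    (le_sup_left : S.1 ≤ _), (le_sup_right : T.1 ≤ _)⟩⟩
  have : Nonempty ι := ⟨⟨⊥, Submodule.fg_bot⟩⟩
  choose E _ _ _ e he using fun S : ι ↦ exists_injective_module (R := R) (K ⧸ S.1)
  -- x dies in K/S as soon as S contains x. An extension to Rⁿ has finitely generated image, so a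
  -- single S kills all of K.
  let f : K →ₗ[R] eventuallyZero R E :=
    (LinearMap.pi fun S ↦ e S ∘ₗ S.1.mkQ).codRestrict _ fun x ↦
      ⟨⟨R ∙ x, Submodule.fg_span_singleton x⟩, fun S hS ↦ by
        have : x ∈ S.1 := hS (Submodule.mem_span_singleton_self x)
        simp [(Submodule.Quotient.mk_eq_zero S.1).2 this]⟩
  obtain ⟨f', hf'⟩ := exists_extend_of_subsingleton_ext K.subtype_injective hg
    (LinearMap.exact_subtype_ker_map g) (h _ (isAbsolutelyWPure_eventuallyZero E)) f
  obtain ⟨S, hS⟩ := exists_forall_eq_zero_of_fg_le_eventuallyZero E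
    (S := LinearMap.range ((eventuallyZero R E).subtype ∘ₗ f'))
    (Module.Finite.iff_fg.1 inferInstance) (by rintro _ ⟨x, rfl⟩; exact (f' x).2)
  have hST : S.1 = ⊤ := by
    refine eq_top_iff.2 fun x _ ↦ (Submodule.Quotient.mk_eq_zero S.1).1 (he S ?_)
    have hx : f' x = f x := LinearMap.congr_fun hf' x
    have := hS _ ⟨x, rfl⟩ S le_rfl
    rw [map_zero, ← this, LinearMap.comp_apply, hx]
    rfl
  exact Module.Finite.iff_fg.1 ⟨hST ▸ S.2⟩

/-! ### `GV`-ideals that are `w`-`FP`-projective -/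

theorem IsGVIdeal.eq_top_of_isWFPProjective {J : Ideal R} (hJ : IsGVIdeal J)
    (h : IsWFPProjective R J) : J = ⊤ := by
  have : Module.Finite R J := Module.Finite.iff_fg.2 hJ.1
  have := h.finitePresentation
  obtain ⟨n, g, hg⟩ := Module.Finite.exists_fin' R J
  set K := LinearMap.ker g with hK
  have : Module.Finite R K := Module.Finite.iff_fg.2 (Module.FinitePresentation.fg_ker g hg)
  let N : Submodule R K := J • ⊤
  have hN : IsAbsolutelyWPure R (K ⧸ N) := hJ.isAbsolutelyWPure fun j hj a ↦ by
    obtain ⟨x, rfl⟩ := N.mkQ_surjective a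
    rw [← map_smul]
    exact (Submodule.Quotient.mk_eq_zero N).2 (Submodule.smul_mem_smul hj trivial)
  obtain ⟨r, hr⟩ := exists_extend_of_subsingleton_ext K.subtype_injective hg
    (LinearMap.exact_subtype_ker_map g) (h _ hN) N.mkQ
  -- s : Rⁿ → K is the identity on K modulo JK, so τ s acts on K as some c in 1 + J.
  obtain ⟨s, hs⟩ := Module.projective_lifting_property N.mkQ r N.mkQ_surjective
  obtain ⟨c, τ, hc, hτ⟩ := exists_comp_eq_smul_of_range_sub_one_le J (s ∘ₗ K.subtype) (by
    rintro _ ⟨x, rfl⟩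
    refine (Submodule.Quotient.mk_eq_zero N).1 ?_
    change N.mkQ (s x - x) = 0
    rw [map_sub, ← LinearMap.comp_apply, hs, sub_eq_zero]
    exact LinearMap.congr_fun hr x)
  let u : (Fin n → R) →ₗ[R] (Fin n → R) := c • LinearMap.id - K.subtype ∘ₗ τ ∘ₗ s
  have hu : LinearMap.ker g ≤ LinearMap.ker u := fun x hx ↦ by
    have := congrArg Subtype.val (LinearMap.congr_fun hτ (⟨x, hx⟩ : K))
    have h2 : (τ (s x) : Fin n → R) = c • x := this
    simp [u, h2]
  have hgu (x) : g (u x) = c • g x := by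
    have : g (τ (s x)) = 0 := (τ (s x)).2
    simp [u, this]
  -- u kills K, so it descends to v with g ∘ v = c on J. As J is GV, v is y ↦ y t, whence c = g(t) ∈
  -- J and 1 ∈ J.
  let v : J →ₗ[R] (Fin n → R) :=
    (LinearMap.ker g).liftQ u hu ∘ₗ (g.quotKerEquivOfSurjective hg).symm.toLinearMap
  have hv (x) : v (g x) = u x := by
    have : (g.quotKerEquivOfSurjective hg).symm (g x) = Submodule.Quotient.mk x := by
      rw [LinearEquiv.symm_apply_eq]; rfl
    simp [v, this]
  choose t ht using fun i : Fin n ↦ hJ.2.2 (LinearMap.proj i ∘ₗ v)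
  have hvt (y : J) : v y = (y : R) • t := by
    ext i
    have := LinearMap.congr_fun (ht i) y
    simpa [mul_comm] using this.symm
  have hct : c - g t = 0 := hJ.eq_zero_of_mul_eq_zero fun j hj ↦ by
    obtain ⟨x, hx⟩ := hg ⟨j, hj⟩
    have h1 := hgu x
    rw [← hv, hvt, hx, map_smul] at h1
    have h2 : j * (g t : R) = c * j := congrArg Subtype.val h1
    rw [sub_mul, ← h2, mul_comm, sub_self]
  rw [sub_eq_zero] at hct
  refine (Ideal.eq_top_iff_one J).2 ?_
  have := J.sub_mem (g t).2 hc
  rwa [hct, sub_sub_cancel] at this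

theorem isDWRing_of_forall_isGVIdeal_eq_top (h : ∀ J : Ideal R, IsGVIdeal J → J = ⊤) :
    IsDWRing R := by
  refine fun I ↦ ⟨fun x ⟨J, hJ, hx⟩ ↦ ?_, fun J hJ ↦ ?_⟩
  · simpa using hx 1 (h J hJ ▸ trivial)
  · refine subsingleton_ext_of_exists_extend J.subtype_injective J.mkQ_surjective
      (LinearMap.exact_subtype_mkQ J) fun f ↦ ?_
    obtain rfl := h J hJ
    exact ⟨f ∘ₗ Submodule.topEquiv.symm.toLinearMap, by ext; rfl⟩

/-! ### Coherent rings -/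

/-- The first coordinate maps M onto a finitely presented ideal; the kernel is therefore finitely
generated and embeds in one fewer coordinate. -/
theorem IsCoherentCommRing.finitePresentation_of_injective (hR : IsCoherentCommRing R) (n : ℕ) :
    ∀ (M : Type u) [AddCommGroup M] [Module R M] [Module.Finite R M] (i : M →ₗ[R] (Fin n → R)),
      Function.Injective i → Module.FinitePresentation R M := by
  induction n with
  | zero =>
    intro M _ _ _ i hi
    have : Subsingleton M := hi.subsingleton
    infer_instance
  | succ n ih =>
    intro M _ _ _ i hi
    let l : M →ₗ[R] R := LinearMap.proj 0 ∘ₗ i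
    have : Module.FinitePresentation R (LinearMap.range l) :=
      hR _ (Module.Finite.iff_fg.1 inferInstance)
    have hl : Function.Surjective l.rangeRestrict := l.surjective_rangeRestrict
    have : Module.Finite R (LinearMap.ker l.rangeRestrict) :=
      Module.Finite.iff_fg.2 (Module.FinitePresentation.fg_ker _ hl)
    have : Module.FinitePresentation R (LinearMap.ker l.rangeRestrict) := by
      refine ih _ (LinearMap.funLeft R R Fin.succ ∘ₗ i ∘ₗ Submodule.subtype _) fun x y hxy ↦ ?_
      refine Subtype.ext (hi (funext fun j ↦ ?_))
      refine Fin.cases ?_ (fun j ↦ congrFun hxy j) j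
      have hx (z : LinearMap.ker l.rangeRestrict) : i z 0 = 0 := congrArg Subtype.val z.2
      rw [hx, hx]
    exact Module.finitePresentation_of_ker _ hl

theorem IsCoherentCommRing.finitePresentation_submodule (hR : IsCoherentCommRing R)
    {P : Type u} [AddCommGroup P] [Module R P] [Module.Projective R P] {N : Submodule R P}
    (hN : N.FG) : Module.FinitePresentation R N := by
  classical
  obtain ⟨s, hs⟩ := Module.projective_def.1 ‹Module.Projective R P›
  have : Module.Finite R N := Module.Finite.iff_fg.2 hN
  obtain ⟨G, hG⟩ := hN
  let T : Finset P := G.biUnion fun x ↦ (s x).support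
  have hT : N ≤ (Finsupp.supported R R (T : Set P)).comap s := by
    rw [← hG, Submodule.span_le]
    intro x hx y hy
    exact Finset.mem_biUnion.2 ⟨x, hx, hy⟩
  refine hR.finitePresentation_of_injective T.card N
    (LinearMap.pi fun j ↦ Finsupp.lapply ((T.equivFin.symm j : T) : P) ∘ₗ s ∘ₗ N.subtype)
    fun x y hxy ↦ Subtype.ext (hs.injective (Finsupp.ext fun a ↦ ?_))
  by_cases ha : a ∈ T
  · simpa using congrFun hxy (T.equivFin ⟨a, ha⟩)
  · rw [(Finsupp.mem_supported' R _).1 (hT x.2) a ha, (Finsupp.mem_supported' R _).1 (hT y.2) a ha]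

/-! ### Pure monomorphisms and finitely presented modules -/

/-- If `i : A → E` stays injective after tensoring with every module, then a linear map to `A` from
a finitely generated submodule `K` of `Rⁿ` extends to `Rⁿ` as soon as its composite with `i`
does. -/
theorem exists_extend_of_rTensor_injective {A E : Type u} [AddCommGroup A] [Module R A]
    [AddCommGroup E] [Module R E] {i : A →ₗ[R] E}
    (hi : ∀ (M : Type u) [AddCommGroup M] [Module R M], Function.Injective (i.rTensor M))
    {n : ℕ} {K : Submodule R (Fin n → R)} (hK : K.FG) (f : K →ₗ[R] A)
    (h : ∃ g : (Fin n → R) →ₗ[R] E, g ∘ₗ K.subtype = i ∘ₗ f) :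
    ∃ f' : (Fin n → R) →ₗ[R] A, f' ∘ₗ K.subtype = f := by
  classical
  obtain ⟨g, hg⟩ := h
  have hgf (x : K) : i (f x) = g x := (LinearMap.congr_fun hg x).symm
  have : Module.Finite R K := Module.Finite.iff_fg.2 hK
  obtain ⟨m, k, hk⟩ := Module.Finite.exists_fin (R := R) (M := K)
  -- The rows of D are generators of K. Extending f means solving D b = (f(k a)) in A; g solves it
  -- in E, so the right-hand side t dies in E ⊗ coker D, hence in A ⊗ coker D.
  let D : (Fin n → R) →ₗ[R] (Fin m → R) :=
    LinearMap.pi fun a ↦ ∑ j, (k a).1 j • LinearMap.proj j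
  have hD (v a) : D v a = ∑ j, (k a).1 j * v j := by simp [D]
  let q := (LinearMap.range D).mkQ
  let t : TensorProduct R A (Fin m → R) := ∑ a, f (k a) ⊗ₜ[R] Pi.single a 1
  have hsum {B : Type u} [AddCommGroup B] [Module R B] (φ : (Fin n → R) →ₗ[R] B) (x) :
      φ x = ∑ j, x j • φ (Pi.single j 1) := by
    conv_lhs => rw [pi_eq_sum_univ' x, map_sum]
    exact Finset.sum_congr rfl fun j _ ↦ by rw [map_smul]
  have ht : q.lTensor A t = 0 := by
    apply hi
    rw [map_zero]
    calc i.rTensor _ (q.lTensor A t)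
        = ∑ a, g (k a).1 ⊗ₜ[R] q (Pi.single a 1) := by simp [t, hgf]
      _ = ∑ a, ∑ j, g (Pi.single j 1) ⊗ₜ[R] q ((k a).1 j • Pi.single a 1) := by
          refine Finset.sum_congr rfl fun a _ ↦ ?_
          rw [hsum g, TensorProduct.sum_tmul]
          exact Finset.sum_congr rfl fun j _ ↦ by rw [TensorProduct.smul_tmul, map_smul]
      _ = ∑ j, g (Pi.single j 1) ⊗ₜ[R] q (D (Pi.single j 1)) := by
          rw [Finset.sum_comm]
          refine Finset.sum_congr rfl fun j _ ↦ ?_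
          rw [← TensorProduct.tmul_sum, ← map_sum]
          congr 2
          ext a
          simp [hD, Pi.single_apply]
      _ = 0 := Finset.sum_eq_zero fun j _ ↦ by
          have : q (D (Pi.single j 1)) = 0 :=
            (Submodule.Quotient.mk_eq_zero _).2 (LinearMap.mem_range_self D _)
          rw [this, TensorProduct.tmul_zero]
  have hex : Function.Exact D q := LinearMap.exact_map_mkQ_range D
  obtain ⟨z, hz⟩ := (lTensor_exact A hex (Submodule.mkQ_surjective _) t).1 ht
  have key (z : TensorProduct R A (Fin n → R)) (a : Fin m) :
      TensorProduct.piScalarRight R R A (Fin m) (D.lTensor A z) a =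
        ∑ j, (k a).1 j • TensorProduct.piScalarRight R R A (Fin n) z j := by
    induction z with
    | zero => simp
    | add x y hx hy => simp only [map_add, Pi.add_apply, hx, hy, smul_add, Finset.sum_add_distrib]
    | tmul x v => simp [hD, Finset.sum_smul, mul_smul]
  let b := TensorProduct.piScalarRight R R A (Fin n) z
  refine ⟨Fintype.linearCombination R b, LinearMap.ext_on_range hk fun a ↦ ?_⟩
  have h1 := key z a
  rw [hz] at h1
  have h2 : TensorProduct.piScalarRight R R A (Fin m) t a = f (k a) := by
    simp [t, Pi.single_apply]
  rw [← h2, h1]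
  simp [Fintype.linearCombination_apply, b]

theorem IsAbsolutelyWPure.rTensor_injective (hR : IsDWRing R) {A : Type u} [AddCommGroup A]
    [Module R A] (hA : IsAbsolutelyWPure R A) {B : Type u} [AddCommGroup B] [Module R B]
    {i : A →ₗ[R] B} (hi : Function.Injective i) (M : Type u) [AddCommGroup M] [Module R M] :
    Function.Injective (i.rTensor M) := by
  have h1 : Function.Injective ((LinearMap.range i).subtype.rTensor M) :=
    -- Over a DW-ring every maximal ideal is a maximal w-ideal, and injectivity is local at these.
    injective_of_localized_maximal _ fun p hp ↦ ((hA B i hi).2 M p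
      ⟨⟨hR p, hp.ne_top⟩, fun I hI hle ↦ (hp.eq_of_le hI.2 hle).ge⟩).1
  have h2 : Function.Injective ((LinearEquiv.ofInjective i hi).toLinearMap.rTensor M) :=
    (LinearEquiv.rTensor M (LinearEquiv.ofInjective i hi)).injective
  have h3 : i = (LinearMap.range i).subtype ∘ₗ (LinearEquiv.ofInjective i hi).toLinearMap := rfl
  rw [h3, LinearMap.rTensor_comp]
  exact h1.comp h2

theorem IsDWRing.isWFPProjective (hR : IsDWRing R) (M : Type u) [AddCommGroup M] [Module R M]
    [Module.FinitePresentation R M] : IsWFPProjective R M := by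
  intro A _ _ hA
  obtain ⟨n, g, hg⟩ := Module.Finite.exists_fin' R M
  obtain ⟨E, _, _, _, i, hi⟩ := exists_injective_module (R := R) A
  exact subsingleton_ext_of_exists_extend (LinearMap.ker g).subtype_injective hg
    (LinearMap.exact_subtype_ker_map g) fun f ↦
      exists_extend_of_rTensor_injective (fun M _ _ ↦ hA.rTensor_injective hR hi M)
        (Module.FinitePresentation.fg_ker g hg) f
        (Module.Injective.extension_property R E _ _ _ (Submodule.subtype_injective _) (i ∘ₗ f))

end

theorem mainTheorem2 (R : Type u) [CommRing R] :
    List.TFAE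
      [IsCoherentCommRing R ∧ IsDWRing R,
       ∀ (P : Type u) [AddCommGroup P] [Module R P] [Module.Projective R P]
         (N : Submodule R P), N.FG → IsWFPProjective R N,
       ∀ I : Ideal R, I.FG → IsWFPProjective R I] := by
  tfae_have 1 → 2 := by
    intro ⟨hc, hR⟩ P _ _ _ N hN
    have := hc.finitePresentation_submodule hN
    exact hR.isWFPProjective N
  tfae_have 2 → 3 := fun h I hI ↦ h R I hI
  tfae_have 3 → 1 := by
    refine fun h ↦ ⟨fun I hI ↦ ?_, isDWRing_of_forall_isGVIdeal_eq_top fun J hJ ↦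
      hJ.eq_top_of_isWFPProjective (h J hJ.1)⟩
    have : Module.Finite R I := Module.Finite.iff_fg.2 hI
    exact (h I hI).finitePresentation
  tfae_finish
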